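/- **Theorem 4.3.** Let $\Omega$ be a compact metric space, $T:\Omega\to\Omega$ a homeomorphism that is minimal and uniquely ergodic, and $\mu$ its unique invariant Borel probability measure. Let $f:\Omega\to\mathbb{D}=\{|w|<1\}$ be continuous and put $\alpha_{x,n}=f(T^nx)$ for $x\in\Omega$, $n\in\mathbb{Z}$. For $|\alpha|\le 1$ let $\rho(\alpha)=(1-|\alpha|^2)^{1/2}$. *Lyapunov exponent.* For $|\alpha|<1$ let $A_z(\alpha)=\rho(\alpha)^{-1}\begin{pmatrix} z&-\overline{\alpha}\\-\alpha z&1\end{pmatrix}$, and set $$L(z)=\lim_{n\to\infty}\frac1n\int_\Omega\log\|A_z(\alpha_{x,n-1})\cdots A_z(\alpha_{x,0})\|\,d\mu(x).$$ *Green's function.* For $n\ge1$, $x\in\Omega$ and $|\beta|=|\gamma|=1$, let $\tilde\alpha_{-1}=\beta$, $\tilde\alpha_{n-1}=\gamma$ and $\tilde\alpha_j=\alpha_{x,j}$ for all other $j\in\mathbb{Z}$. Let $$\Theta_j=\begin{pmatrix}\overline{\tilde\alpha_j}&\rho(\tilde\alpha_j)\\ \rho(\tilde\alpha_j)&-\tilde\alpha_j\end{pmatrix}$$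 act on $\ell^2(\{j,j+1\})$, and let $\mathcal{L}^{[0,n-1]}_{x;\beta,\gamma}$ and $\mathcal{M}^{[0,n-1]}_{x;\beta,\gamma}$ be the compressions to $\ell^2(\{0,\dots,n-1\})$ of $\bigoplus_{j\text{ even}}\Theta_j$ and $\bigoplus_{j\text{ odd}}\Theta_j$. Whenever the inverse exists, let $$G^{[0,n-1]}_{x;\beta,\gamma}(z;k,\ell)=\Big\langle\delta_k,\big(z(\mathcal{L}^{[0,n-1]}_{x;\beta,\gamma})^*-\mathcal{M}^{[0,n-1]}_{x;\beta,\gamma}\big)^{-1}\delta_\ell\Big\rangle .$$ Let $|z|=1$, $0<m<L(z)$, $\delta>0$ and $|\beta_0|=|\gamma_0|=1$. Then for every sufficiently large $n$ there is a measurable set $\Omega_n\subseteq\Omega$ with $\mu(\Omega_n)\ge1-\delta$ such that for every $x\in\Omega_n$ there exist $\beta\in\{-\beta_0,\beta_0\}$ and $\gamma\in\{-\gamma_0,\gamma_0\}$ for which $z(\mathcal{L}^{[0,n-1]}_{x;\beta,\gamma})^*-\mathcal{M}^{[0,n-1]}_{x;\beta,\gamma}$ is invertible and $$|G^{[0,n-1]}_{x;\beta,\gamma}(z;k,\ell)|\le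 e^{-m|k-\ell|}$$ for all $k\in\{0,n-1\}$ and all integers $\ell$ with $\frac n3\le\ell\le\frac{2n}3$. -/

import Mathlib

open MeasureTheory Filter Topology
open scoped Matrix ComplexConjugate

noncomputable section

namespace CMV

/-- `(Ω, μ, T)` is strictly ergodic: `T` is minimal (every orbit is dense) and uniquely ergodic,
with `μ` its unique invariant Borel probability measure. -/
structure IsStrictlyErgodic {Ω : Type*} [TopologicalSpace Ω] [MeasurableSpace Ω]
    (μ : Measure Ω) (T : Ω ≃ₜ Ω) : Prop where
  isProbabilityMeasure : IsProbabilityMeasure μ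
  measurePreserving : MeasurePreserving T μ μ
  unique : ∀ ν : Measure Ω, IsProbabilityMeasure ν → MeasurePreserving T ν ν → ν = μ
  minimal : ∀ x : Ω, Dense (Set.range fun n : ℤ => (T ^ n) x)

/-- The Verblunsky coefficients `α_{x,n} = f (T^n x)`, `n ∈ ℤ`. -/
def verblunsky {Ω : Type*} [TopologicalSpace Ω] (T : Ω ≃ₜ Ω) (f : Ω → ℂ) (x : Ω) : ℤ → ℂ :=
  fun n => f ((T ^ n) x)

/-- `ρ = (1 - |α|²)^{1/2}`. -/
def rho (a : ℂ) : ℝ := Real.sqrt (1 - ‖a‖ ^ 2)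

/-- The `2 × 2` block `Θ` of a Verblunsky coefficient. -/
def theta (a : ℂ) : Matrix (Fin 2) (Fin 2) ℂ :=
  !![conj a, (rho a : ℂ); (rho a : ℂ), -a]

/-- Matrix (in the standard basis of `ℓ²(ℤ)`) of the direct sum of `Θ_n = theta (α n)`, acting on
`ℓ²({n, n+1})`, over the integers `n` with `P n`. It is used only for `P = Even` and `P = Odd`, for
which the sets `{n, n+1}` partition `ℤ`. -/
def thetaSum (P : ℤ → Prop) [DecidablePred P] (α : ℤ → ℂ) : Matrix ℤ ℤ ℂ := fun i j =>
  if i = j then (if P i then conj (α i) else -α (i - 1))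
  else if j = i + 1 ∧ P i then (rho (α i) : ℂ)
  else if i = j + 1 ∧ P j then (rho (α j) : ℂ)
  else 0

/-- `𝓛 = ⨁_{n even} Θ_n`. -/
def opL (α : ℤ → ℂ) : Matrix ℤ ℤ ℂ := thetaSum Even α

/-- `𝓜 = ⨁_{n odd} Θ_n`. -/
def opM (α : ℤ → ℂ) : Matrix ℤ ℤ ℂ := thetaSum Odd α

theorem opL_block (α : ℤ → ℂ) (n : ℤ) (hn : Even n) :
    (opL α).submatrix ![n, n + 1] ![n, n + 1] = theta (α n) := by
  have h : ¬ Even (n + 1) := by simpa [Int.even_add_one] using hn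
  ext i j
  fin_cases i <;> fin_cases j <;> simp [opL, thetaSum, theta, hn, h]

theorem opM_block (α : ℤ → ℂ) (n : ℤ) (hn : Odd n) :
    (opM α).submatrix ![n, n + 1] ![n, n + 1] = theta (α n) := by
  have h : ¬ Odd (n + 1) := by
    rw [Int.not_odd_iff_even]; exact hn.add_one
  ext i j
  fin_cases i <;> fin_cases j <;> simp [opM, thetaSum, theta, hn, h]

/-- The restriction `X^{[a,b]}` to `ℓ²([a,b])`. -/
def restrict (X : Matrix ℤ ℤ ℂ) (a b : ℤ) : Matrix (Finset.Icc a b) (Finset.Icc a b) ℂ :=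
  X.submatrix (fun i => (i : ℤ)) (fun i => (i : ℤ))

/-- The coefficients used for the restriction to `[a,b]` with boundary conditions `β, γ`:
`α_{a-1}` is replaced by `β` and `α_b` by `γ`. -/
def withBoundary (α : ℤ → ℂ) (a b : ℤ) (β γ : ℂ) : ℤ → ℂ := fun n =>
  if n = a - 1 then β else if n = b then γ else α n

/-- The matrix `z (𝓛^{[a,b]}_{β,γ})^* - 𝓜^{[a,b]}_{β,γ}`. -/
def pencil (α : ℤ → ℂ) (a b : ℤ) (β γ z : ℂ) :
    Matrix (Finset.Icc a b) (Finset.Icc a b) ℂ :=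
  z • (restrict (opL (withBoundary α a b β γ)) a b)ᴴ - restrict (opM (withBoundary α a b β γ)) a b

/-- The Green's function `G^{[a,b]}_{β,γ}(z; k, ℓ)`; meaningful when `pencil α a b β γ z` is
invertible. -/
def green (α : ℤ → ℂ) (a b : ℤ) (β γ z : ℂ) (k l : Finset.Icc a b) : ℂ :=
  (pencil α a b β γ z)⁻¹ k l

/-- The one-step transfer matrix `A_z(α)`. -/
def stepMatrix (z a : ℂ) : Matrix (Fin 2) (Fin 2) ℂ :=
  ((rho a : ℂ))⁻¹ • !![z, -conj a; -a * z, 1]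

/-- The `n`-step transfer matrix `A_z(α_{n-1}) ⋯ A_z(α_0)`. -/
def transfer (α : ℤ → ℂ) (z : ℂ) : ℕ → Matrix (Fin 2) (Fin 2) ℂ
  | 0 => 1
  | n + 1 => stepMatrix z (α n) * transfer α z n

/-- The operator norm on `ℂ²` with its Euclidean norm. -/
def opNorm (A : Matrix (Fin 2) (Fin 2) ℂ) : ℝ :=
  ‖Matrix.toEuclideanCLM (n := Fin 2) (𝕜 := ℂ) A‖

/-- The Lyapunov exponent `L(z) = lim_{n → ∞} (1/n) ∫ log ‖T_{x;n}(z)‖ dμ(x)`. -/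
def lyapunov {Ω : Type*} [TopologicalSpace Ω] [MeasurableSpace Ω] (μ : Measure Ω) (T : Ω ≃ₜ Ω)
    (f : Ω → ℂ) (z : ℂ) : ℝ :=
  limUnder atTop fun n : ℕ =>
    (1 / (n : ℝ)) * ∫ x, Real.log (opNorm (transfer (verblunsky T f x) z n)) ∂μ

end CMV

end

/-!
The matrix `P = z (𝓛^{[0,b]})^* - 𝓜^{[0,b]}`, `b = n - 1`, is symmetric and tridiagonal, and the
equation `P u = 0` is the Szegő recursion in disguise: from any `v ∈ ℂ²` one gets, by reading off
alternately the two components of `T_j v` (with `T_j` the `j`-step transfer matrix) and multiplying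
by powers of `z`, a sequence solving every row of `P u = 0` except the first and the last
(`exists_pencil_mulVec_szegoSolution`). The choice `v = (1, -β)` also solves the first row, the
choice `v = adj(T_b) (1, zγ)` also solves the last one, and in both cases the remaining entry has
modulus `‖w‖`, where `w = boundaryForm T_b β (zγ)`. So `P` is invertible when `w ≠ 0`, and the
rows `b` and `0` of `P⁻¹` are the first and the second solution, divided by `w` up to a unimodular
factor. Their entries in column `l` are therefore at most `2 ‖T_l(x)‖ / ‖w‖` and
`2 ‖T_{b-l}(T^l x)‖ / ‖w‖` in absolute value (`isUnit_pencil_and_norm_green_le`).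

For the denominator, the vectors `(1, ±β₀)` form an orthogonal basis of `ℂ²`, and so do
`(zγ₀, ±1)`; hence for one choice of the signs `4 ‖w‖ ≥ ‖T_b(x)‖`
(`exists_opNorm_le_boundaryForm`).

It remains to control `log ‖T_n(x)‖`, a continuous subadditive cocycle. Unique ergodicity makes
Birkhoff averages of continuous functions converge uniformly, whence
`log ‖T_n(x)‖ ≤ n (L + ε)` for all `x` once `n` is large (`eventually_logTransfer_le`). Since
`∫ log ‖T_n‖ dμ ≥ n L` by Fekete's lemma, this uniform upper bound and Markov's inequality give
`log ‖T_n(x)‖ ≥ n (L - ε)` outside a set of small measure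
(`eventually_measure_le_logTransfer`). For `n/3 ≤ l ≤ 2n/3` the two estimates combine to
`|G(k, l)| ≤ 8 exp (-L |k - l| + 2 n ε)`, which is at most `exp (-m |k - l|)` for large `n` when
`ε = (L - m) / 12`, because `|k - l|` is at least about `n/3`.
-/

/-! ### Uniform convergence in uniquely ergodic systems -/

namespace CMV

/-- The empirical measure of the orbit segment `x, T x, …, T^{n-1} x`. For `n = 0` there is no
such measure, and any probability measure is allowed. -/
theorem exists_empirical_measure {Ω : Type*} [TopologicalSpace Ω] [MeasurableSpace Ω]
    [BorelSpace Ω] (T : Ω → Ω) (n : ℕ) (x : Ω) :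
    ∃ ν : ProbabilityMeasure Ω, n ≠ 0 → ∀ h : Ω → ℝ, Continuous h →
      ∫ y, h y ∂(ν : Measure Ω) = birkhoffAverage ℝ T h n x := by
  rcases Nat.eq_zero_or_pos n with rfl | hn
  · exact ⟨⟨Measure.dirac x, inferInstance⟩, by simp⟩
  have hn0 : (n : ENNReal) ≠ 0 := by exact_mod_cast hn.ne'
  refine ⟨⟨(n : ENNReal)⁻¹ • ∑ k ∈ Finset.range n, Measure.dirac (T^[k] x), ⟨?_⟩⟩,
    fun _ h hh => ?_⟩
  · simp [ENNReal.inv_mul_cancel hn0 (ENNReal.natCast_ne_top n)]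
  · have hi : ∀ y : Ω, Integrable h (Measure.dirac y) := fun y =>
      (integrable_dirac' hh.measurable.stronglyMeasurable (by simp))
    simp only [ProbabilityMeasure.coe_mk]
    rw [integral_smul_measure, integral_finsetSum_measure (fun i _ => hi _)]
    simp only [integral_dirac' _ _ hh.measurable.stronglyMeasurable]
    simp [birkhoffAverage, birkhoffSum]

/-- Unique ergodicity bounds Birkhoff averages of continuous functions uniformly in the point:
a limit of empirical measures along which the bound fails would be an invariant probability measure
other than `μ`. -/
theorem eventually_birkhoffAverage_lt {Ω : Type*} [MetricSpace Ω] [CompactSpace Ω]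
    [MeasurableSpace Ω] [BorelSpace Ω] {μ : Measure Ω} {T : Ω → Ω} (hT : Continuous T)
    (huniq : ∀ ν : Measure Ω, IsProbabilityMeasure ν → MeasurePreserving T ν ν → ν = μ)
    {g : Ω → ℝ} (hg : Continuous g) {c : ℝ} (hc : ∫ x, g x ∂μ < c) :
    ∀ᶠ n : ℕ in atTop, ∀ x, birkhoffAverage ℝ T g n x < c := by
  by_contra hcon
  have hfreq : ∃ᶠ n : ℕ in atTop, ∃ x, c ≤ birkhoffAverage ℝ T g n x := by
    rw [Filter.Frequently]
    simpa only [not_exists, not_le] using hcon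
  have : Nonempty Ω := by
    obtain ⟨_, x, _⟩ := hfreq.exists
    exact ⟨x⟩
  have hx : ∀ n : ℕ, ∃ x : Ω, (∃ y, c ≤ birkhoffAverage ℝ T g n y) →
      c ≤ birkhoffAverage ℝ T g n x := by
    intro n
    by_cases h : ∃ y, c ≤ birkhoffAverage ℝ T g n y
    · exact ⟨h.choose, fun _ => h.choose_spec⟩
    · exact ⟨Classical.arbitrary Ω, fun h' => absurd h' h⟩
  choose x hx using hx
  choose ν hν using fun n => exists_empirical_measure T n (x n)
  have hne : (atTop ⊓ 𝓟 {n : ℕ | ∃ y, c ≤ birkhoffAverage ℝ T g n y}).NeBot :=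
    frequently_iff_neBot.mp hfreq
  obtain ⟨U, hU⟩ := exists_ultrafilter_le
    (atTop ⊓ 𝓟 {n : ℕ | ∃ y, c ≤ birkhoffAverage ℝ T g n y})
  have hUtop : (U : Filter ℕ) ≤ atTop := hU.trans inf_le_left
  have hUg : ∀ᶠ n in (U : Filter ℕ), c ≤ birkhoffAverage ℝ T g n (x n) := by
    filter_upwards [(hU.trans inf_le_right) (mem_principal_self _)] with n hn using hx n hn
  obtain ⟨ν₀, -, hν₀⟩ := isCompact_univ.ultrafilter_le_nhds (U.map ν) (by simp)
  have hlim : ∀ h : Ω → ℝ, Continuous h →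
      Tendsto (fun n => birkhoffAverage ℝ T h n (x n)) U
        (𝓝 (∫ y, h y ∂(ν₀ : Measure Ω))) := by
    intro h hh
    have h1 := (ProbabilityMeasure.tendsto_iff_forall_integral_tendsto.mp
      (show Tendsto ν U (𝓝 ν₀) from hν₀)) (BoundedContinuousFunction.mkOfCompact ⟨h, hh⟩)
    refine h1.congr' ?_
    filter_upwards [hUtop (eventually_ne_atTop 0)] with n hn
    exact hν n hn h hh
  -- The limit is invariant, since the Birkhoff sums of `h ∘ T` and `h` differ by two terms only.
  have hinv : MeasurePreserving T (ν₀ : Measure Ω) ν₀ := by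
    refine ⟨hT.measurable, ?_⟩
    have : IsProbabilityMeasure (Measure.map T (ν₀ : Measure Ω)) :=
      Measure.isProbabilityMeasure_map hT.measurable.aemeasurable
    refine ext_of_forall_integral_eq_of_IsFiniteMeasure fun h => ?_
    rw [integral_map hT.measurable.aemeasurable h.continuous.aestronglyMeasurable]
    have h1 := hlim (fun y => h (T y)) (h.continuous.comp hT)
    have h2 := hlim h h.continuous
    have h3 : Tendsto (fun n : ℕ => birkhoffAverage ℝ T (fun y => h (T y)) n (x n) -
        birkhoffAverage ℝ T h n (x n)) atTop (𝓝 0) := by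
      have h4 : Tendsto (fun n : ℕ => (2 * ‖h‖) / (n : ℝ)) atTop (𝓝 0) :=
        tendsto_const_div_atTop_nhds_zero_nat _
      refine squeeze_zero_norm (fun n => ?_) h4
      have h5 : birkhoffAverage ℝ T (fun y => h (T y)) n (x n) =
          birkhoffAverage ℝ T h n (T (x n)) := by
        simp only [birkhoffAverage, birkhoffSum]
        congr 1
        refine Finset.sum_congr rfl fun k _ => ?_
        rw [← Function.iterate_succ_apply, ← Function.iterate_succ_apply' T k]
      rw [h5, birkhoffAverage_apply_sub_birkhoffAverage, norm_smul, norm_inv, div_eq_inv_mul]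
      have h6 := h.norm_coe_le_norm (T^[n] (x n))
      have h7 := h.norm_coe_le_norm (x n)
      have h8 := norm_sub_le (h (T^[n] (x n))) (h (x n))
      rw [Real.norm_natCast]
      gcongr
      linarith
    have h9 := tendsto_nhds_unique (h1.sub h2) (h3.mono_left hUtop)
    linarith
  have hμ := huniq ν₀ inferInstance hinv
  have := ge_of_tendsto (hlim g hg) hUg
  rw [hμ] at this
  linarith

/-- A subadditive cocycle is dominated by the Birkhoff sums of `a N / N` up to a bounded error.
Averaging over the `N` ways to cut an orbit segment into blocks of length `N` produces the sums
along `T` itself, so that no ergodicity of `T^N` is needed. -/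
theorem exists_mul_le_birkhoffSum {Ω : Type*} {T : Ω → Ω} {a : ℕ → Ω → ℝ}
    (hsub : ∀ m n x, a (m + n) x ≤ a m x + a n (T^[m] x))
    (hbdd : ∀ n, ∃ C, ∀ x, |a n x| ≤ C) (N : ℕ) (hN : N ≠ 0) :
    ∃ C, ∀ n x, N * a (n + N) x ≤ C + birkhoffSum T (a N) n x := by
  choose B hB using hbdd
  set s : ℕ → Ω → ℝ := fun n x => ∑ j ∈ Finset.range N, a (n + (N - j)) (T^[j] x) with hs
  -- Splitting `N` steps off each summand advances the base point by `N`.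
  have hstep : ∀ n x, s (n + N) x ≤ birkhoffSum T (a N) N x + s n (T^[N] x) := by
    intro n x
    simp only [hs, birkhoffSum, ← Finset.sum_add_distrib]
    refine Finset.sum_le_sum fun j _ => ?_
    have h := hsub N (n + (N - j)) (T^[j] x)
    rw [← Function.iterate_add_apply, add_comm N j, Function.iterate_add_apply] at h
    rwa [show n + N + (N - j) = N + (n + (N - j)) by ring]
  -- Without a point of `Ω` the bound `B n` could be negative.
  have hBnn : ∀ n, ∀ x : Ω, 0 ≤ B n := fun n x => (abs_nonneg _).trans (hB n x)
  set C₁ : ℝ := ∑ r ∈ Finset.range N,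
    (∑ j ∈ Finset.range N, B (r + (N - j)) + ∑ _j ∈ Finset.range r, B N) with hC₁
  have hmain : ∀ n x, s n x ≤ C₁ + birkhoffSum T (a N) n x := by
    intro n
    induction n using Nat.strong_induction_on with
    | _ n ih =>
      intro x
      rcases lt_or_ge n N with hn | hn
      · have h1 : s n x ≤ ∑ j ∈ Finset.range N, B (n + (N - j)) :=
          Finset.sum_le_sum fun j _ => (le_abs_self _).trans (hB _ _)
        have h2 : -∑ _j ∈ Finset.range n, B N ≤ birkhoffSum T (a N) n x := by
          rw [← Finset.sum_neg_distrib]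
          exact Finset.sum_le_sum fun j _ => (abs_le.mp (hB N _)).1
        have h3 : ∑ j ∈ Finset.range N, B (n + (N - j)) + ∑ _j ∈ Finset.range n, B N ≤ C₁ :=
          Finset.single_le_sum
            (f := fun r => ∑ j ∈ Finset.range N, B (r + (N - j)) + ∑ _j ∈ Finset.range r, B N)
            (fun r _ => add_nonneg (Finset.sum_nonneg fun _ _ => hBnn _ x)
              (Finset.sum_nonneg fun _ _ => hBnn _ x)) (Finset.mem_range.mpr hn)
        linarith
      · obtain ⟨k, rfl⟩ := Nat.exists_eq_add_of_le' hn
        have h1 := ih k (by omega) (T^[N] x)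
        have h2 := hstep k x
        rw [add_comm k N, birkhoffSum_add, add_comm N k]
        linarith
  refine ⟨∑ j ∈ Finset.range N, B j + C₁, fun n x => ?_⟩
  have h1 : N * a (n + N) x ≤ ∑ j ∈ Finset.range N, B j + s n x := by
    have : (N : ℝ) * a (n + N) x = ∑ _j ∈ Finset.range N, a (n + N) x := by simp
    rw [this, hs]
    simp only [← Finset.sum_add_distrib]
    refine Finset.sum_le_sum fun j hj => ?_
    have hj' := Finset.mem_range.mp hj
    have h := hsub j (n + (N - j)) x
    rw [show j + (n + (N - j)) = n + N by omega] at h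
    linarith [(abs_le.mp (hB j x)).2]
  linarith [hmain n x]

theorem eventually_subadditive_le {Ω : Type*} [MetricSpace Ω] [CompactSpace Ω]
    [MeasurableSpace Ω] [BorelSpace Ω] {μ : Measure Ω} {T : Ω → Ω} (hT : Continuous T)
    (huniq : ∀ ν : Measure Ω, IsProbabilityMeasure ν → MeasurePreserving T ν ν → ν = μ)
    {a : ℕ → Ω → ℝ} (ha : ∀ n, Continuous (a n))
    (hsub : ∀ m n x, a (m + n) x ≤ a m x + a n (T^[m] x))
    {N : ℕ} (hN : N ≠ 0) {c : ℝ} (hc : ∫ x, a N x ∂μ < N * c) :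
    ∀ᶠ n : ℕ in atTop, ∀ x, a n x ≤ n * c := by
  have hbdd : ∀ n, ∃ C, ∀ x, |a n x| ≤ C := fun n => by
    obtain ⟨C, hC⟩ := isCompact_univ.exists_bound_of_continuousOn (ha n).continuousOn
    exact ⟨C, fun x => hC x trivial⟩
  obtain ⟨C, hC⟩ := exists_mul_le_birkhoffSum hsub hbdd N hN
  obtain ⟨d, hd, hdc⟩ := exists_between hc
  have hN' : (0 : ℝ) < N := by positivity
  have h1 := eventually_birkhoffAverage_lt hT huniq (ha N) hd
  have h2 : ∀ᶠ n : ℕ in atTop, C - N * N * c ≤ n * (N * c - d) :=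
    (tendsto_natCast_atTop_atTop.atTop_mul_const (sub_pos.mpr hdc)).eventually_ge_atTop _
  have h3 : ∀ᶠ n : ℕ in atTop, ∀ x, a (n + N) x ≤ ((n + N : ℕ) : ℝ) * c := by
    filter_upwards [h1, h2, eventually_gt_atTop 0] with n h1 h2 hn x
    have h4 := h1 x
    rw [birkhoffAverage, smul_eq_mul, inv_mul_lt_iff₀ (by positivity)] at h4
    have h5 := hC n x
    refine le_of_mul_le_mul_left ?_ hN'
    push_cast
    linarith
  rw [eventually_atTop] at h3 ⊢
  obtain ⟨M, hM⟩ := h3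
  refine ⟨M + N, fun n hn => ?_⟩
  have := hM (n - N) (by omega)
  rwa [Nat.sub_add_cancel (by omega)] at this

/-! ### Norms of transfer matrices -/

theorem opNorm_mul_le (A B : Matrix (Fin 2) (Fin 2) ℂ) : opNorm (A * B) ≤ opNorm A * opNorm B := by
  unfold opNorm
  rw [map_mul]
  exact norm_mul_le _ _

theorem continuous_opNorm : Continuous opNorm :=
  continuous_norm.comp <| LinearMap.continuous_of_finiteDimensional
    (Matrix.toEuclideanCLM (n := Fin 2) (𝕜 := ℂ)).toAlgEquiv.toLinearMap

theorem norm_apply_le_opNorm (A : Matrix (Fin 2) (Fin 2) ℂ) (i j : Fin 2) :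
    ‖A i j‖ ≤ opNorm A := by
  have h := (Matrix.toEuclideanCLM (n := Fin 2) (𝕜 := ℂ) A).le_opNorm
    (EuclideanSpace.single j 1)
  have h2 := PiLp.norm_apply_le
    (Matrix.toEuclideanCLM (n := Fin 2) (𝕜 := ℂ) A (EuclideanSpace.single j 1)) i
  rw [Matrix.ofLp_toEuclideanCLM] at h2
  simp at h h2
  exact h2.trans h

theorem opNorm_le_sum (A : Matrix (Fin 2) (Fin 2) ℂ) :
    opNorm A ≤ ‖A 0 0‖ + ‖A 0 1‖ + ‖A 1 0‖ + ‖A 1 1‖ := by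
  refine ContinuousLinearMap.opNorm_le_bound _ (by positivity) fun v => ?_
  have h0 := PiLp.norm_apply_le v 0
  have h1 := PiLp.norm_apply_le v 1
  have key : ∀ w : EuclideanSpace ℂ (Fin 2), ‖w‖ ≤ ‖w 0‖ + ‖w 1‖ := fun w => by
    rw [EuclideanSpace.norm_eq, Fin.sum_univ_two]
    refine Real.sqrt_le_iff.mpr ⟨by positivity, ?_⟩
    nlinarith [mul_nonneg (norm_nonneg (w 0)) (norm_nonneg (w 1))]
  refine (key _).trans ?_
  have hrow : ∀ i, ‖(Matrix.toEuclideanCLM (n := Fin 2) (𝕜 := ℂ) A v) i‖ ≤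
      (‖A i 0‖ + ‖A i 1‖) * ‖v‖ := fun i => by
    rw [Matrix.ofLp_toEuclideanCLM]
    simp only [Matrix.mulVec, dotProduct, Fin.sum_univ_two]
    refine (norm_add_le _ _).trans ?_
    rw [norm_mul, norm_mul, add_mul]
    gcongr
  linarith [hrow 0, hrow 1]

/-- The constant `1 / 2` is not optimal, but any positive one serves: the bound only has to keep
`log ‖T_n‖` bounded below. -/
theorem half_le_opNorm_of_norm_det {A : Matrix (Fin 2) (Fin 2) ℂ} (hA : ‖A.det‖ = 1) :
    1 / 2 ≤ opNorm A := by
  rw [Matrix.det_fin_two] at hA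
  have h := norm_sub_le (A 0 0 * A 1 1) (A 0 1 * A 1 0)
  rw [hA, norm_mul, norm_mul] at h
  have hn : 0 ≤ opNorm A := norm_nonneg _
  have h1 := mul_le_mul (norm_apply_le_opNorm A 0 0) (norm_apply_le_opNorm A 1 1)
    (norm_nonneg _) hn
  have h2 := mul_le_mul (norm_apply_le_opNorm A 0 1) (norm_apply_le_opNorm A 1 0)
    (norm_nonneg _) hn
  nlinarith

theorem rho_pos {a : ℂ} (ha : ‖a‖ < 1) : 0 < rho a :=
  Real.sqrt_pos.mpr (by nlinarith [norm_nonneg a])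

theorem rho_sq {a : ℂ} (ha : ‖a‖ ≤ 1) : (rho a : ℂ) ^ 2 = 1 - a * conj a := by
  rw [← Complex.ofReal_pow, rho, Real.sq_sqrt (by nlinarith [norm_nonneg a]),
    Complex.mul_conj, Complex.normSq_eq_norm_sq]
  push_cast
  ring

theorem rho_eq_zero {a : ℂ} (ha : ‖a‖ = 1) : rho a = 0 := by simp [rho, ha]

theorem det_stepMatrix (z : ℂ) {a : ℂ} (ha : ‖a‖ < 1) : (stepMatrix z a).det = z := by
  have h := rho_sq ha.le
  have h0 : (rho a : ℂ) ≠ 0 := by exact_mod_cast (rho_pos ha).ne'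
  rw [stepMatrix, Matrix.det_smul, Matrix.det_fin_two]
  simp
  field_simp
  rw [h]
  ring

theorem det_transfer (z : ℂ) {α : ℤ → ℂ} (hα : ∀ n, ‖α n‖ < 1) (n : ℕ) :
    (transfer α z n).det = z ^ n := by
  induction n with
  | zero => simp [transfer]
  | succ n ih => rw [transfer, Matrix.det_mul, ih, det_stepMatrix z (hα _), pow_succ']

theorem transfer_add (α : ℤ → ℂ) (z : ℂ) (m n : ℕ) :
    transfer α z (m + n) = transfer (fun k => α (m + k)) z n * transfer α z m := by
  induction n with
  | zero => simp [transfer]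
  | succ n ih => rw [← add_assoc, transfer, ih, transfer, Matrix.mul_assoc, Nat.cast_add]

theorem verblunsky_shift {Ω : Type*} [TopologicalSpace Ω] (T : Ω ≃ₜ Ω) (f : Ω → ℂ) (x : Ω)
    (m : ℕ) : (fun k => verblunsky T f x (m + k)) = verblunsky T f (T^[m] x) := by
  have h : ∀ m : ℕ, (T ^ m) x = T^[m] x := fun m => by
    induction m with
    | zero => rfl
    | succ m ih => rw [pow_succ', Function.iterate_succ_apply', ← ih]; rfl
  funext k
  rw [verblunsky, verblunsky, add_comm, zpow_add, zpow_natCast, ← h]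
  rfl

/-- The logarithm of the norm of the `n`-step transfer matrix at `x`. -/
noncomputable def logTransfer {Ω : Type*} [TopologicalSpace Ω] (T : Ω ≃ₜ Ω) (f : Ω → ℂ) (z : ℂ)
    (n : ℕ) (x : Ω) : ℝ :=
  Real.log (opNorm (transfer (verblunsky T f x) z n))

section Cocycle

variable {Ω : Type*} [TopologicalSpace Ω] {T : Ω ≃ₜ Ω} {f : Ω → ℂ} {z : ℂ}

theorem half_le_opNorm_transfer {α : ℤ → ℂ} (hα : ∀ n, ‖α n‖ < 1) (hz : ‖z‖ = 1) (n : ℕ) :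
    1 / 2 ≤ opNorm (transfer α z n) :=
  half_le_opNorm_of_norm_det (by rw [det_transfer z hα, norm_pow, hz, one_pow])

theorem opNorm_transfer_pos {α : ℤ → ℂ} (hα : ∀ n, ‖α n‖ < 1) (hz : ‖z‖ = 1) (n : ℕ) :
    0 < opNorm (transfer α z n) :=
  one_half_pos.trans_le (half_le_opNorm_transfer hα hz n)

theorem continuous_logTransfer (hf : Continuous f) (hfd : ∀ x, ‖f x‖ < 1) (hz : ‖z‖ = 1)
    (n : ℕ) : Continuous (logTransfer T f z n) := by
  refine Continuous.log ?_ fun x => (opNorm_transfer_pos (fun _ => hfd _) hz n).ne'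
  refine continuous_opNorm.comp ?_
  induction n with
  | zero => exact continuous_const
  | succ n ih =>
    refine Continuous.matrix_mul ?_ ih
    have h1 : Continuous fun x => verblunsky T f x n := hf.comp (T ^ (n : ℤ)).continuous
    have h2 : Continuous fun x => (rho (verblunsky T f x n) : ℂ) := by
      unfold rho
      fun_prop
    refine (h2.inv₀ fun x => ?_).smul ?_
    · exact_mod_cast (rho_pos (hfd _)).ne'
    · refine continuous_matrix fun i j => ?_
      fin_cases i <;> fin_cases j <;> simp <;> fun_prop

theorem logTransfer_add_le (hfd : ∀ x, ‖f x‖ < 1) (hz : ‖z‖ = 1) (m n : ℕ) (x : Ω) :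
    logTransfer T f z (m + n) x ≤ logTransfer T f z m x + logTransfer T f z n (T^[m] x) := by
  have hp := fun x n => opNorm_transfer_pos (α := verblunsky T f x) (fun _ => hfd _) hz n
  unfold logTransfer
  rw [← Real.log_mul (hp _ _).ne' (hp _ _).ne', transfer_add, verblunsky_shift, mul_comm]
  refine Real.log_le_log ?_ (opNorm_mul_le _ _)
  rw [← verblunsky_shift, ← transfer_add]
  exact hp _ _

theorem neg_log_two_le_logTransfer (hfd : ∀ x, ‖f x‖ < 1) (hz : ‖z‖ = 1) (n : ℕ) (x : Ω) :
    -Real.log 2 ≤ logTransfer T f z n x := by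
  rw [← Real.log_inv, ← one_div]
  exact Real.log_le_log one_half_pos (half_le_opNorm_transfer (fun _ => hfd _) hz n)

end Cocycle

/-! ### Upper and lower bounds from the Lyapunov exponent -/

section Lyapunov

variable {Ω : Type*} [MetricSpace Ω] [CompactSpace Ω] [MeasurableSpace Ω] [BorelSpace Ω]
  {μ : Measure Ω} {T : Ω ≃ₜ Ω} {f : Ω → ℂ} {z : ℂ}

theorem integrable_logTransfer [IsFiniteMeasure μ] (hf : Continuous f) (hfd : ∀ x, ‖f x‖ < 1)
    (hz : ‖z‖ = 1) (n : ℕ) : Integrable (logTransfer T f z n) μ :=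
  (continuous_logTransfer hf hfd hz n).integrable_of_hasCompactSupport
    (HasCompactSupport.of_compactSpace _)

/-- By Fekete's lemma the limit defining the Lyapunov exponent exists, so that `limUnder` does not
take a junk value, and it is an infimum. -/
theorem lyapunov_le_and_exists_lt (hT : IsStrictlyErgodic μ T) (hf : Continuous f)
    (hfd : ∀ x, ‖f x‖ < 1) (hz : ‖z‖ = 1) :
    (∀ n : ℕ, n * lyapunov μ T f z ≤ ∫ x, logTransfer T f z n x ∂μ) ∧
      ∀ c, lyapunov μ T f z < c →
        ∃ n : ℕ, n ≠ 0 ∧ ∫ x, logTransfer T f z n x ∂μ < n * c := by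
  have := hT.isProbabilityMeasure
  have hi := fun n => integrable_logTransfer (μ := μ) (T := T) hf hfd hz n
  set u : ℕ → ℝ := fun n => ∫ x, logTransfer T f z n x ∂μ with hu
  have hmp : ∀ m : ℕ, MeasurePreserving (T^[m]) μ μ := fun m => hT.measurePreserving.iterate m
  have hshift : ∀ m n : ℕ, ∫ x, logTransfer T f z n (T^[m] x) ∂μ = u n := fun m n => by
    conv_rhs => rw [hu, ← (hmp m).map_eq]
    exact (integral_map (hmp m).measurable.aemeasurable
      (continuous_logTransfer hf hfd hz n).aestronglyMeasurable).symm
  have hsub : Subadditive u := fun m n => by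
    have hi' : Integrable (fun x => logTransfer T f z n (T^[m] x)) μ :=
      (hmp m).integrable_comp_of_integrable (hi n)
    have h1 := integral_mono (hi (m + n)) ((hi m).add hi')
      (fun x => logTransfer_add_le hfd hz m n x)
    simp only [Pi.add_apply] at h1
    rwa [integral_add (hi m) hi', hshift] at h1
  have hbdd : BddBelow (Set.range fun n : ℕ => u n / n) := by
    refine ⟨-Real.log 2, ?_⟩
    rintro _ ⟨n, rfl⟩
    have h2 : 0 ≤ Real.log 2 := Real.log_nonneg one_le_two
    rcases Nat.eq_zero_or_pos n with rfl | hn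
    · simpa using h2
    have h1 : -Real.log 2 ≤ u n := by
      have := integral_mono (μ := μ) (integrable_const (-Real.log 2)) (hi n)
        (fun x => neg_log_two_le_logTransfer hfd hz n x)
      simpa using this
    have hn1 : (1 : ℝ) ≤ n := by exact_mod_cast hn
    rw [le_div_iff₀ (by positivity)]
    nlinarith
  have hlim := hsub.tendsto_lim hbdd
  have hL : lyapunov μ T f z = hsub.lim := by
    refine Tendsto.limUnder_eq (hlim.congr fun n => ?_)
    rw [div_eq_mul_inv, mul_comm, one_div]
    rfl
  rw [hL]
  refine ⟨fun n => ?_, fun c hc => ?_⟩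
  · rcases Nat.eq_zero_or_pos n with rfl | hn
    · simp [logTransfer, transfer, opNorm]
    · have h := hsub.lim_le_div hbdd hn.ne'
      rwa [le_div_iff₀ (by positivity), mul_comm] at h
  · obtain ⟨n, h1, h2⟩ := ((hlim.eventually_lt_const hc).and (eventually_gt_atTop 0)).exists
    refine ⟨n, h2.ne', ?_⟩
    rwa [div_lt_iff₀ (by positivity), mul_comm] at h1

/-- The exponential growth rate of the transfer matrices is at most the Lyapunov exponent,
uniformly in `x`. -/
theorem eventually_logTransfer_le (hT : IsStrictlyErgodic μ T) (hf : Continuous f)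
    (hfd : ∀ x, ‖f x‖ < 1) (hz : ‖z‖ = 1) {c : ℝ} (hc : lyapunov μ T f z < c) :
    ∀ᶠ n : ℕ in atTop, ∀ x, logTransfer T f z n x ≤ n * c := by
  obtain ⟨N, hN, hNc⟩ := (lyapunov_le_and_exists_lt hT hf hfd hz).2 c hc
  exact eventually_subadditive_le T.continuous hT.unique
    (continuous_logTransfer hf hfd hz) (logTransfer_add_le hfd hz) hN hNc

/-- On most of `Ω` the transfer matrices grow at least at a rate slightly below the Lyapunov
exponent: the mean of `log ‖T_n‖` is close to its uniform upper bound, so Markov's inequality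
applies to the difference of the two. -/
theorem eventually_measure_le_logTransfer (hT : IsStrictlyErgodic μ T) (hf : Continuous f)
    (hfd : ∀ x, ‖f x‖ < 1) (hz : ‖z‖ = 1) {c : ℝ} (hc : c < lyapunov μ T f z)
    {δ : ℝ} (hδ : 0 < δ) :
    ∀ᶠ n : ℕ in atTop, 1 - δ ≤ μ.real {x | n * c ≤ logTransfer T f z n x} := by
  have := hT.isProbabilityMeasure
  set L := lyapunov μ T f z with hLdef
  have hε : 0 < δ * (L - c) := mul_pos hδ (sub_pos.mpr hc)
  filter_upwards [eventually_logTransfer_le hT hf hfd hz (lt_add_of_pos_right L hε),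
    eventually_gt_atTop 0] with n hn hn0
  have hn0' : (0 : ℝ) < n := by exact_mod_cast hn0
  have hi := integrable_logTransfer (μ := μ) (T := T) hf hfd hz n
  have hL := (lyapunov_le_and_exists_lt hT hf hfd hz).1 n
  set g : Ω → ℝ := fun x => n * (L + δ * (L - c)) - logTransfer T f z n x with hg
  have hmarkov := mul_meas_ge_le_integral_of_nonneg (μ := μ) (f := g)
    (Eventually.of_forall fun x => sub_nonneg.mpr (hn x)) ((integrable_const _).sub hi)
    (n * (L - c))
  have hint : ∫ x, g x ∂μ ≤ n * (δ * (L - c)) := by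
    rw [hg, integral_sub (integrable_const _) hi, integral_const]
    simp
    linarith
  have hmeas : MeasurableSet {x | n * c ≤ logTransfer T f z n x} :=
    measurableSet_le measurable_const (continuous_logTransfer hf hfd hz n).measurable
  have hcompl : μ.real {x | n * c ≤ logTransfer T f z n x}ᶜ ≤
      μ.real {x | n * (L - c) ≤ g x} := by
    refine measureReal_mono fun x hx => ?_
    simp only [Set.mem_compl_iff, Set.mem_ofPred_eq, not_le] at hx ⊢
    simp only [hg]
    nlinarith [mul_pos hn0' hε]
  have h1 : μ.real {x | n * (L - c) ≤ g x} ≤ δ := by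
    have h2 : 0 < n * (L - c) := mul_pos hn0' (sub_pos.mpr hc)
    refine le_of_mul_le_mul_left ?_ h2
    linarith
  rw [probReal_compl_eq_one_sub hmeas] at hcompl
  linarith

end Lyapunov

/-! ### The rows of the tridiagonal matrix -/

section Rows

/-- The row `i` has its diagonal entry and one more, to the right or to the left of it
according to `P i`. -/
theorem thetaSum_eq (P : ℤ → Prop) [DecidablePred P] (hP : ∀ i, P (i + 1) ↔ ¬P i) (α : ℤ → ℂ)
    (i j : ℤ) :
    thetaSum P α i j =
      (if i = j then (if P i then conj (α i) else -α (i - 1)) else 0) +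
      (if (if P i then i + 1 else i - 1) = j then
        (if P i then (rho (α i) : ℂ) else (rho (α (i - 1)) : ℂ)) else 0) := by
  have h1 := hP (i - 1)
  rw [sub_add_cancel] at h1
  unfold thetaSum
  by_cases hi : P i
  · have h2 : ¬P (i - 1) := h1.mp hi
    by_cases hij : i = j
    · subst hij; simp [hi]
    · by_cases hj : i + 1 = j
      · subst hj; simp [hi]
      · have hj' : ¬ j = i + 1 := fun h => hj h.symm
        have h3 : ¬ (i = j + 1 ∧ P j) := by
          rintro ⟨rfl, h⟩
          exact (hP j).mp hi h
        simp [hi, hij, hj, hj', h3]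
  · have h2 : P (i - 1) := by
      by_contra h
      exact hi (h1.mpr h)
    by_cases hij : i = j
    · subst hij; simp [hi]
    · by_cases hj : i - 1 = j
      · subst hj
        have h3 : ¬ i = i - 1 := by omega
        simp [hi, h2, h3]
      · have hj' : ¬ i = j + 1 := by omega
        simp [hi, hij, hj, hj']

theorem thetaSum_symm (P : ℤ → Prop) [DecidablePred P] (α : ℤ → ℂ) (i j : ℤ) :
    thetaSum P α j i = thetaSum P α i j := by
  unfold thetaSum
  by_cases hij : i = j
  · subst hij; rfl
  · have hji : ¬ j = i := fun h => hij h.symm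
    simp only [hij, hji, if_false]
    split_ifs <;> first | rfl | omega

theorem rho_conj (a : ℂ) : rho (conj a) = rho a := by simp [rho]

theorem conj_thetaSum (P : ℤ → Prop) [DecidablePred P] (α : ℤ → ℂ) (i j : ℤ) :
    conj (thetaSum P α i j) = thetaSum P (fun k => conj (α k)) i j := by
  unfold thetaSum
  split_ifs <;> simp [rho_conj]

theorem sum_thetaSum_mul (P : ℤ → Prop) [DecidablePred P] (hP : ∀ i, P (i + 1) ↔ ¬P i)
    {α : ℤ → ℂ} {a b : ℤ} (ha : rho (α (a - 1)) = 0) (hb : rho (α b) = 0) (u : ℤ → ℂ)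
    (i : Finset.Icc a b) :
    ∑ j : Finset.Icc a b, thetaSum P α i j * u j =
      if P i then conj (α i) * u i + rho (α i) * u (i + 1)
      else -α (i - 1) * u i + rho (α (i - 1)) * u (i - 1) := by
  obtain ⟨i, hi⟩ := i
  rw [Finset.sum_coe_sort (Finset.Icc a b) (fun j : ℤ => thetaSum P α i j * u j)]
  simp only [thetaSum_eq P hP, add_mul, Finset.sum_add_distrib, ite_mul, zero_mul,
    Finset.sum_ite_eq, hi, if_true]
  rw [Finset.mem_Icc] at hi
  by_cases hPi : P i
  · simp only [hPi, if_true, Finset.mem_Icc]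
    split_ifs with h
    · rfl
    · have : i = b := by omega
      simp [this, hb]
  · simp only [hPi, if_false, Finset.mem_Icc]
    split_ifs with h
    · rfl
    · have : i = a := by omega
      simp [this, ha]

theorem even_add_one_iff (i : ℤ) : Even (i + 1) ↔ ¬Even i := Int.even_add_one

theorem odd_add_one_iff (i : ℤ) : Odd (i + 1) ↔ ¬Odd i := by
  rw [← Int.not_even_iff_odd, ← Int.not_even_iff_odd, Int.even_add_one]

theorem pencil_apply (α : ℤ → ℂ) (a b : ℤ) (β γ z : ℂ) (i j : Finset.Icc a b) :
    pencil α a b β γ z i j =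
      z * thetaSum Even (fun k => conj (withBoundary α a b β γ k)) i j -
        thetaSum Odd (withBoundary α a b β γ) i j := by
  simp only [pencil, restrict, opL, opM, Matrix.sub_apply, Matrix.smul_apply,
    Matrix.conjTranspose_apply, Matrix.submatrix_apply, smul_eq_mul]
  rw [← conj_thetaSum, thetaSum_symm Even]
  rfl

theorem pencil_transpose (α : ℤ → ℂ) (a b : ℤ) (β γ z : ℂ) :
    (pencil α a b β γ z)ᵀ = pencil α a b β γ z := by
  ext i j
  rw [Matrix.transpose_apply, pencil_apply, pencil_apply, thetaSum_symm Even,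
    thetaSum_symm Odd]

theorem withBoundary_left (α : ℤ → ℂ) (a b : ℤ) (β γ : ℂ) :
    withBoundary α a b β γ (a - 1) = β := by simp [withBoundary]

theorem withBoundary_right (α : ℤ → ℂ) {a b : ℤ} (hab : a ≤ b) (β γ : ℂ) :
    withBoundary α a b β γ b = γ := by
  have : ¬ b = a - 1 := by omega
  simp [withBoundary, this]

theorem withBoundary_of_mem (α : ℤ → ℂ) {a b i : ℤ} (h1 : a ≤ i) (h2 : i < b) (β γ : ℂ) :
    withBoundary α a b β γ i = α i := by
  have : ¬ i = a - 1 := by omega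
  simp [withBoundary, this, h2.ne]

/-- The rows of `z 𝓛^* - 𝓜`, applied to a sequence on `ℤ`. The values of `u` outside `[a, b]` do
not matter, because `ρ` vanishes on the unimodular boundary coefficients. -/
theorem pencil_mulVec_apply (α : ℤ → ℂ) {a b : ℤ} (hab : a ≤ b) {β γ : ℂ} (hβ : ‖β‖ = 1)
    (hγ : ‖γ‖ = 1) (z : ℂ) (u : ℤ → ℂ) (i : Finset.Icc a b) :
    (pencil α a b β γ z *ᵥ fun j => u j) i =
      let α' := withBoundary α a b β γ
      if Even (i : ℤ) then
        z * (α' i * u i + rho (α' i) * u (i + 1)) -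
          (-α' (i - 1) * u i + rho (α' (i - 1)) * u (i - 1))
      else
        z * (-conj (α' (i - 1)) * u i + rho (α' (i - 1)) * u (i - 1)) -
          (conj (α' i) * u i + rho (α' i) * u (i + 1)) := by
  have hl : rho (withBoundary α a b β γ (a - 1)) = 0 := by
    rw [withBoundary_left, rho_eq_zero hβ]
  have hr : rho (withBoundary α a b β γ b) = 0 := by
    rw [withBoundary_right α hab, rho_eq_zero hγ]
  simp only [Matrix.mulVec, dotProduct, pencil_apply, sub_mul, mul_assoc,
    Finset.sum_sub_distrib, ← Finset.mul_sum]
  rw [sum_thetaSum_mul Odd odd_add_one_iff hl hr,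
    sum_thetaSum_mul Even even_add_one_iff (by rwa [rho_conj]) (by rwa [rho_conj])]
  simp only [rho_conj, Complex.conj_conj, ← Int.not_even_iff_odd]
  by_cases h : Even (i : ℤ) <;> simp [h]

end Rows

/-! ### Solutions from the Szegő recursion -/

section Solutions

variable {α : ℤ → ℂ} {z : ℂ}

/-- The solution of `z 𝓛^* u = 𝓜 u` on `i ≥ 0` with initial data `v = (u_0, (𝓜 u)_0)`: up to a power
of `z`, the first component of `T_i v` for even `i` and the second one for odd `i`. The other
component, with the same power of `z`, is the common value of `z 𝓛^* u` and `𝓜 u` at `i`, up to a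
factor `z` for odd `i`. At negative `i` the value is meaningless. -/
noncomputable def szegoSolution (α : ℤ → ℂ) (z : ℂ) (v : Fin 2 → ℂ) (i : ℤ) : ℂ :=
  z ^ (-((i + 1) / 2)) *
    (if Even i then (transfer α z i.toNat *ᵥ v) 0 else (transfer α z i.toNat *ᵥ v) 1)

theorem transfer_succ_mulVec (z : ℂ) (v : Fin 2 → ℂ) {n : ℕ} (hα : ‖α n‖ < 1) :
    rho (α n) * (transfer α z (n + 1) *ᵥ v) 0 =
        z * (transfer α z n *ᵥ v) 0 - conj (α n) * (transfer α z n *ᵥ v) 1 ∧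
      rho (α n) * (transfer α z (n + 1) *ᵥ v) 1 =
        -α n * z * (transfer α z n *ᵥ v) 0 + (transfer α z n *ᵥ v) 1 := by
  have h0 : (rho (α n) : ℂ) ≠ 0 := by exact_mod_cast (rho_pos hα).ne'
  rw [transfer, ← Matrix.mulVec_mulVec]
  generalize transfer α z n *ᵥ v = y
  constructor
  · simp [stepMatrix, Matrix.mulVec, dotProduct, Fin.sum_univ_two]
    field_simp
    ring
  · simp [stepMatrix, Matrix.mulVec, dotProduct, Fin.sum_univ_two]
    field_simp

/-- The Szegő recursion, solved for the earlier vector. -/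
theorem transfer_mulVec_of_succ (z : ℂ) (v : Fin 2 → ℂ) {n : ℕ} (hα : ‖α n‖ < 1) :
    rho (α n) * (z * (transfer α z n *ᵥ v) 0) =
        (transfer α z (n + 1) *ᵥ v) 0 + conj (α n) * (transfer α z (n + 1) *ᵥ v) 1 ∧
      rho (α n) * (transfer α z n *ᵥ v) 1 =
        α n * (transfer α z (n + 1) *ᵥ v) 0 + (transfer α z (n + 1) *ᵥ v) 1 := by
  have h0 : (rho (α n) : ℂ) ≠ 0 := by exact_mod_cast (rho_pos hα).ne'
  obtain ⟨h1, h2⟩ := transfer_succ_mulVec z v hα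
  have h := rho_sq hα.le
  refine ⟨mul_left_cancel₀ h0 ?_, mul_left_cancel₀ h0 ?_⟩
  · linear_combination h * z * (transfer α z n *ᵥ v) 0 - h1 - conj (α n) * h2
  · linear_combination h * (transfer α z n *ᵥ v) 1 - α n * h1 - h2

theorem zpow_half_of_even (hz : z ≠ 0) {i : ℤ} (hi : Even i) :
    z ^ (-((i + 1) / 2)) = z * z ^ (-((i + 1 + 1) / 2)) := by
  obtain ⟨k, rfl⟩ := hi
  rw [show (k + k + 1) / 2 = k by omega, show (k + k + 1 + 1) / 2 = k + 1 by omega,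
    ← zpow_one_add₀ hz]
  congr 1
  ring

theorem zpow_half_of_not_even {i : ℤ} (hi : ¬Even i) :
    z ^ (-((i + 1 + 1) / 2)) = z ^ (-((i + 1) / 2)) := by
  obtain ⟨k, rfl⟩ := Int.not_even_iff_odd.mp hi
  congr 2
  omega

theorem szegoSolution_even (α : ℤ → ℂ) (z : ℂ) (v : Fin 2 → ℂ) {i : ℕ} (hi : Even (i : ℤ)) :
    szegoSolution α z v i = z ^ (-(((i : ℤ) + 1) / 2)) * (transfer α z i *ᵥ v) 0 := by
  simp [szegoSolution, hi]

theorem szegoSolution_odd (α : ℤ → ℂ) (z : ℂ) (v : Fin 2 → ℂ) {i : ℕ} (hi : ¬Even (i : ℤ)) :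
    szegoSolution α z v i = z ^ (-(((i : ℤ) + 1) / 2)) * (transfer α z i *ᵥ v) 1 := by
  simp only [szegoSolution, if_neg hi, Int.toNat_natCast]

/-- This and the next three lemmas compute `z 𝓛^* u` and `𝓜 u` for a Szegő solution `u`. The block
coupling `i` to `i + 1` belongs to `𝓛` for even `i` and to `𝓜` for odd `i`; it is seen from its first
index in the forward lemmas and from its second index in the backward lemmas. -/
theorem szegoSolution_forward_even (hz : z ≠ 0) (v : Fin 2 → ℂ) {i : ℕ} (hα : ‖α i‖ < 1)
    (hi : Even (i : ℤ)) :
    z * (α i * szegoSolution α z v i + rho (α i) * szegoSolution α z v (i + 1)) =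
      z ^ (-(((i : ℤ) + 1) / 2)) * (transfer α z i *ᵥ v) 1 := by
  have hi' : ¬Even ((i + 1 : ℕ) : ℤ) := by rw [Nat.cast_add_one, Int.even_add_one]; simpa using hi
  have h := (transfer_succ_mulVec z v hα).2
  rw [szegoSolution_even α z v hi, ← Nat.cast_add_one, szegoSolution_odd α z v hi',
    Nat.cast_add_one, zpow_half_of_even hz hi]
  linear_combination z * z ^ (-(((i : ℤ) + 1 + 1) / 2)) * h

theorem szegoSolution_forward_odd (v : Fin 2 → ℂ) {i : ℕ} (hα : ‖α i‖ < 1)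
    (hi : ¬Even (i : ℤ)) :
    conj (α i) * szegoSolution α z v i + rho (α i) * szegoSolution α z v (i + 1) =
      z ^ (-(((i : ℤ) + 1) / 2)) * (z * (transfer α z i *ᵥ v) 0) := by
  have hi' : Even ((i + 1 : ℕ) : ℤ) := by rwa [Nat.cast_add_one, Int.even_add_one]
  have h := (transfer_succ_mulVec z v hα).1
  rw [szegoSolution_odd α z v hi, ← Nat.cast_add_one, szegoSolution_even α z v hi',
    Nat.cast_add_one, zpow_half_of_not_even hi]
  linear_combination z ^ (-(((i : ℤ) + 1) / 2)) * h

theorem szegoSolution_backward_even (v : Fin 2 → ℂ) {i : ℕ} (hα : ‖α i‖ < 1)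
    (hi : ¬Even (i : ℤ)) :
    -α i * szegoSolution α z v (i + 1) + rho (α i) * szegoSolution α z v i =
      z ^ (-(((i : ℤ) + 1 + 1) / 2)) * (transfer α z (i + 1) *ᵥ v) 1 := by
  have hi' : Even ((i + 1 : ℕ) : ℤ) := by rwa [Nat.cast_add_one, Int.even_add_one]
  have h := (transfer_mulVec_of_succ z v hα).2
  rw [szegoSolution_odd α z v hi, ← Nat.cast_add_one, szegoSolution_even α z v hi',
    Nat.cast_add_one, zpow_half_of_not_even hi]
  linear_combination z ^ (-(((i : ℤ) + 1) / 2)) * h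

theorem szegoSolution_backward_odd (hz : z ≠ 0) (v : Fin 2 → ℂ) {i : ℕ} (hα : ‖α i‖ < 1)
    (hi : Even (i : ℤ)) :
    z * (-conj (α i) * szegoSolution α z v (i + 1) + rho (α i) * szegoSolution α z v i) =
      z ^ (-(((i : ℤ) + 1 + 1) / 2)) * (z * (transfer α z (i + 1) *ᵥ v) 0) := by
  have hi' : ¬Even ((i + 1 : ℕ) : ℤ) := by rw [Nat.cast_add_one, Int.even_add_one]; simpa using hi
  have h := (transfer_mulVec_of_succ z v hα).1
  rw [szegoSolution_even α z v hi, ← Nat.cast_add_one, szegoSolution_odd α z v hi',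
    Nat.cast_add_one, zpow_half_of_even hz hi]
  linear_combination z * z ^ (-(((i : ℤ) + 1 + 1) / 2)) * h

theorem exists_norm_szegoSolution_eq (hz : ‖z‖ = 1) (v : Fin 2 → ℂ) (i : ℕ) :
    ∃ j, ‖szegoSolution α z v i‖ = ‖(transfer α z i *ᵥ v) j‖ := by
  by_cases hi : Even (i : ℤ)
  · exact ⟨0, by rw [szegoSolution_even α z v hi, norm_mul, norm_zpow, hz, one_zpow, one_mul]⟩
  · exact ⟨1, by rw [szegoSolution_odd α z v hi, norm_mul, norm_zpow, hz, one_zpow, one_mul]⟩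

/-- A Szegő solution satisfies the eigenvalue equation in all rows except the two boundary rows, and
in these the defect is a linear functional of `v` and of `T_b v`, respectively. In the last row it
is `T_b` that enters, not `T_{b+1}`, because `α_b` has been replaced by `γ`. -/
theorem exists_pencil_mulVec_szegoSolution (hα : ∀ n, ‖α n‖ < 1) (hz : ‖z‖ = 1) {β γ : ℂ}
    (hβ : ‖β‖ = 1) (hγ : ‖γ‖ = 1) {b : ℕ} (hb : b ≠ 0) (v : Fin 2 → ℂ) :
    ∃ κ : ℂ, ‖κ‖ = 1 ∧ ∀ i : Finset.Icc (0 : ℤ) b,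
      (pencil α 0 b β γ z *ᵥ fun j => szegoSolution α z v j) i =
        (if (i : ℤ) = 0 then v 1 + β * v 0 else 0) +
        (if (i : ℤ) = b then
          κ * (z * γ * (transfer α z b *ᵥ v) 0 - (transfer α z b *ᵥ v) 1) else 0) := by
  have hz0 : z ≠ 0 := by rintro rfl; simp at hz
  refine ⟨z ^ (-(((b : ℤ) + 1) / 2)) * (if Even (b : ℤ) then 1 else conj γ), ?_, ?_⟩
  · rw [norm_mul, norm_zpow, hz, one_zpow, one_mul]
    split_ifs <;> simp [hγ]
  rintro ⟨i, hi⟩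
  rw [pencil_mulVec_apply α (Int.natCast_nonneg b) hβ hγ]
  rw [Finset.mem_Icc] at hi
  obtain ⟨i, rfl⟩ := Int.eq_ofNat_of_zero_le hi.1
  simp only
  rcases Nat.eq_zero_or_pos i with rfl | hi0
  · have hl := withBoundary_left α 0 b β γ
    have hm := withBoundary_of_mem α le_rfl (show (0 : ℤ) < b by omega) β γ
    have hf := szegoSolution_forward_even hz0 v (hα (0 : ℕ)) (by simp)
    have hb' : ¬ ((0 : ℤ) = b) := by omega
    have he := szegoSolution_even α z v (i := 0) (by simp)
    simp only [Nat.cast_zero] at hf he ⊢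
    rw [if_pos (by simp), hl, hm, hf, rho_eq_zero hβ, he, if_neg hb']
    simp [transfer]
  · obtain ⟨k, rfl⟩ := Nat.exists_eq_add_of_le' hi0
    have hl := withBoundary_of_mem α (Int.natCast_nonneg k) (show (k : ℤ) < b by omega) β γ
    have hne : ¬ ((k : ℤ) + 1 = 0) := by omega
    push_cast
    rw [add_sub_cancel_right, hl, if_neg hne, zero_add]
    rcases eq_or_ne (k + 1) b with rfl | hkb
    · have hr := withBoundary_right α (show (0 : ℤ) ≤ (k + 1 : ℕ) by omega) β γ
      have hnorm : γ * conj γ = 1 := by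
        rw [Complex.mul_conj, Complex.normSq_eq_norm_sq, hγ]; simp
      push_cast at hr ⊢
      rw [if_pos rfl, hr, rho_eq_zero hγ]
      by_cases hk : Even (k : ℤ)
      · have hk1 : ¬Even ((k : ℤ) + 1) := by rw [Int.even_add_one]; simpa using hk
        have ho := szegoSolution_odd α z v (i := k + 1) (by exact_mod_cast hk1)
        push_cast at ho
        rw [if_neg hk1, if_neg hk1, szegoSolution_backward_odd hz0 v (hα _) hk, ho]
        push_cast
        linear_combination -(z ^ (-(((k : ℤ) + 1 + 1) / 2)) * z *
          (transfer α z (k + 1) *ᵥ v) 0) * hnorm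
      · have hk1 : Even ((k : ℤ) + 1) := by rwa [Int.even_add_one]
        have ho := szegoSolution_even α z v (i := k + 1) (by exact_mod_cast hk1)
        push_cast at ho
        rw [if_pos hk1, if_pos hk1, szegoSolution_backward_even v (hα _) hk, ho]
        push_cast
        ring
    · have hr := withBoundary_of_mem α (show (0 : ℤ) ≤ (k : ℤ) + 1 by omega)
        (show (k : ℤ) + 1 < b by omega) β γ
      have hne' : ¬ ((k : ℤ) + 1 = b) := by omega
      rw [hr, if_neg hne']
      by_cases hk : Even (k : ℤ)
      · have hk1 : ¬Even ((k : ℤ) + 1) := by rw [Int.even_add_one]; simpa using hk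
        have hf := szegoSolution_forward_odd (z := z) v (i := k + 1) (hα _)
          (by exact_mod_cast hk1)
        push_cast at hf
        rw [if_neg hk1, szegoSolution_backward_odd hz0 v (hα _) hk, hf, sub_self]
      · have hk1 : Even ((k : ℤ) + 1) := by rwa [Int.even_add_one]
        have hf := szegoSolution_forward_even hz0 v (i := k + 1) (hα _)
          (by exact_mod_cast hk1)
        push_cast at hf
        rw [if_pos hk1, szegoSolution_backward_even v (hα _) hk, hf, sub_self]

end Solutions

/-! ### The Green's function through transfer matrices -/

section Green

variable {α : ℤ → ℂ} {z : ℂ}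

/-- The functional `(x, y) ↦ c x - y` evaluated at `A (1, -β)`. For `A = T_b` and `c = z γ` it is, up
to nonzero factors, the determinant of `z 𝓛^* - 𝓜` on `[0, b]` with boundary conditions `β, γ`. -/
noncomputable def boundaryForm (A : Matrix (Fin 2) (Fin 2) ℂ) (β c : ℂ) : ℂ :=
  c * (A 0 0 - β * A 0 1) - (A 1 0 - β * A 1 1)

theorem exists_opNorm_le_boundaryForm (A : Matrix (Fin 2) (Fin 2) ℂ) {z β₀ γ₀ : ℂ}
    (hz : ‖z‖ = 1) (hβ : ‖β₀‖ = 1) (hγ : ‖γ₀‖ = 1) :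
    ∃ β ∈ ({-β₀, β₀} : Set ℂ), ∃ γ ∈ ({-γ₀, γ₀} : Set ℂ),
      opNorm A ≤ 4 * ‖boundaryForm A β (z * γ)‖ := by
  by_contra! h
  have h1 := h (-β₀) (by simp) (-γ₀) (by simp)
  have h2 := h (-β₀) (by simp) γ₀ (by simp)
  have h3 := h β₀ (by simp) (-γ₀) (by simp)
  have h4 := h β₀ (by simp) γ₀ (by simp)
  have hs := opNorm_le_sum A
  set w₁ := boundaryForm A (-β₀) (z * -γ₀) with hw₁
  set w₂ := boundaryForm A (-β₀) (z * γ₀) with hw₂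
  set w₃ := boundaryForm A β₀ (z * -γ₀) with hw₃
  set w₄ := boundaryForm A β₀ (z * γ₀) with hw₄
  -- Each entry of `A` is, up to a unimodular factor, the mean of the four forms with signs.
  have key : ∀ c a s₁ s₂ s₃ s₄ : ℂ, ‖c‖ = 1 → ‖s₁‖ = 1 → ‖s₂‖ = 1 → ‖s₃‖ = 1 → ‖s₄‖ = 1 →
      4 * (c * a) = s₁ * w₁ + s₂ * w₂ + s₃ * w₃ + s₄ * w₄ →
      4 * ‖a‖ ≤ ‖w₁‖ + ‖w₂‖ + ‖w₃‖ + ‖w₄‖ := by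
    intro c a s₁ s₂ s₃ s₄ hc hs₁ hs₂ hs₃ hs₄ h
    have h' := congrArg norm h
    rw [norm_mul, norm_mul, hc, one_mul, RCLike.norm_ofNat] at h'
    rw [h']
    refine (norm_add₄_le).trans ?_
    simp only [norm_mul, hs₁, hs₂, hs₃, hs₄, one_mul, le_refl]
  have e1 := key (z * γ₀) (A 0 0) (-1) 1 (-1) 1 (by simp [hz, hγ]) (by simp) (by simp) (by simp)
    (by simp) (by simp only [hw₁, hw₂, hw₃, hw₄, boundaryForm]; ring)
  have e2 := key (z * γ₀ * β₀) (A 0 1) (-1) 1 1 (-1) (by simp [hz, hγ, hβ]) (by simp) (by simp)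
    (by simp) (by simp) (by simp only [hw₁, hw₂, hw₃, hw₄, boundaryForm]; ring)
  have e3 := key 1 (A 1 0) (-1) (-1) (-1) (-1) (by simp) (by simp) (by simp)
    (by simp) (by simp) (by simp only [hw₁, hw₂, hw₃, hw₄, boundaryForm]; ring)
  have e4 := key β₀ (A 1 1) (-1) (-1) 1 1 hβ (by simp) (by simp)
    (by simp) (by simp) (by simp only [hw₁, hw₂, hw₃, hw₄, boundaryForm]; ring)
  linarith

/-- The off-diagonal entries do not vanish, so the rows of `P x = 0` determine `x` from its first
entry. -/
theorem eq_zero_of_pencil_mulVec_eq_zero (hα : ∀ n, ‖α n‖ < 1) (hz : ‖z‖ = 1) {β γ : ℂ}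
    (hβ : ‖β‖ = 1) (hγ : ‖γ‖ = 1) {b : ℕ} {x : Finset.Icc (0 : ℤ) b → ℂ}
    (hx : pencil α 0 b β γ z *ᵥ x = 0)
    (hx0 : x ⟨0, Finset.mem_Icc.mpr ⟨le_rfl, Int.natCast_nonneg b⟩⟩ = 0) : x = 0 := by
  have hz0 : z ≠ 0 := by rintro rfl; simp at hz
  set u : ℤ → ℂ := fun i => if h : i ∈ Finset.Icc (0 : ℤ) b then x ⟨i, h⟩ else 0 with hu
  have hxu : x = fun j : Finset.Icc (0 : ℤ) b => u j := by
    funext j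
    simp only [hu, dif_pos j.2]
  have hstart : u (-1) = 0 := by simp [hu]
  -- Row `i` expresses the value at `i + 1` through those at `i` and `i - 1`.
  have hmain : ∀ i : ℕ, (i : ℤ) ≤ b → u ((i : ℤ) - 1) = 0 ∧ u i = 0 := by
    intro i
    induction i with
    | zero =>
      intro _
      refine ⟨by simpa using hstart, ?_⟩
      simp only [hu, Nat.cast_zero]
      rw [dif_pos]
      exact hx0
    | succ i ih =>
      intro hib
      push_cast at hib ⊢
      obtain ⟨h1, h2⟩ := ih (by omega)
      rw [add_sub_cancel_right]
      refine ⟨h2, ?_⟩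
      have hrow := congrFun hx ⟨i, Finset.mem_Icc.mpr ⟨Int.natCast_nonneg i, by omega⟩⟩
      rw [hxu, pencil_mulVec_apply α (Int.natCast_nonneg b) hβ hγ] at hrow
      have hm := withBoundary_of_mem α (Int.natCast_nonneg i) (show (i : ℤ) < b by omega) β γ
      have hρ : rho (α i) ≠ 0 := (rho_pos (hα _)).ne'
      simp only [hm, h1, h2] at hrow
      split_ifs at hrow <;> simpa [hz0, hρ] using hrow
  funext j
  obtain ⟨j, hj⟩ := j
  have hj' := Finset.mem_Icc.mp hj
  obtain ⟨i, rfl⟩ := Int.eq_ofNat_of_zero_le hj'.1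
  rw [hxu]
  exact (hmain i hj'.2).2

theorem norm_mulVec_le {v : Fin 2 → ℂ} (h0 : ‖v 0‖ = 1) (h1 : ‖v 1‖ = 1)
    (A : Matrix (Fin 2) (Fin 2) ℂ) (i : Fin 2) : ‖(A *ᵥ v) i‖ ≤ 2 * opNorm A := by
  simp only [Matrix.mulVec, dotProduct, Fin.sum_univ_two]
  refine (norm_add_le _ _).trans ?_
  rw [norm_mul, norm_mul, h0, h1]
  linarith [norm_apply_le_opNorm A i 0, norm_apply_le_opNorm A i 1]

theorem norm_adjugate_mulVec_le {v : Fin 2 → ℂ} (h0 : ‖v 0‖ = 1) (h1 : ‖v 1‖ = 1)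
    (A : Matrix (Fin 2) (Fin 2) ℂ) (i : Fin 2) : ‖(A.adjugate *ᵥ v) i‖ ≤ 2 * opNorm A := by
  simp only [Matrix.mulVec, dotProduct, Fin.sum_univ_two, Matrix.adjugate_fin_two]
  refine (norm_add_le _ _).trans ?_
  rw [norm_mul, norm_mul, h0, h1]
  have h00 := norm_apply_le_opNorm A 0 0
  have h01 := norm_apply_le_opNorm A 0 1
  have h10 := norm_apply_le_opNorm A 1 0
  have h11 := norm_apply_le_opNorm A 1 1
  fin_cases i <;> simp <;> linarith

/-- If the boundary form does not vanish, the matrix is invertible and the first and last rows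
of its inverse are bounded by transfer matrices over the part of the interval beyond `l` and before
`l`, respectively. -/
theorem isUnit_pencil_and_norm_green_le (hα : ∀ n, ‖α n‖ < 1) (hz : ‖z‖ = 1) {β γ : ℂ}
    (hβ : ‖β‖ = 1) (hγ : ‖γ‖ = 1) {b : ℕ} (hb : b ≠ 0)
    (hw : boundaryForm (transfer α z b) β (z * γ) ≠ 0) :
    IsUnit (pencil α 0 b β γ z) ∧ ∀ (k : Finset.Icc (0 : ℤ) b) (l : ℕ)
      (hl : (l : ℤ) ∈ Finset.Icc (0 : ℤ) b),
      ((k : ℤ) = 0 → ‖green α 0 b β γ z k ⟨l, hl⟩‖ ≤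
        2 * opNorm (transfer (fun j => α (l + j)) z (b - l)) /
          ‖boundaryForm (transfer α z b) β (z * γ)‖) ∧
      ((k : ℤ) = b → ‖green α 0 b β γ z k ⟨l, hl⟩‖ ≤
        2 * opNorm (transfer α z l) / ‖boundaryForm (transfer α z b) β (z * γ)‖) := by
  set A := transfer α z b with hA
  set w := boundaryForm A β (z * γ) with hwdef
  set P := pencil α 0 b β γ z with hP
  set v₁ : Fin 2 → ℂ := ![1, -β] with hv₁
  set v₂ : Fin 2 → ℂ := ![1, z * γ] with hv₂
  obtain ⟨κ, hκ, hφ⟩ := exists_pencil_mulVec_szegoSolution hα hz hβ hγ hb v₁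
  obtain ⟨κ', -, hψ⟩ := exists_pencil_mulVec_szegoSolution hα hz hβ hγ hb (A.adjugate *ᵥ v₂)
  set φ : Finset.Icc (0 : ℤ) b → ℂ := fun j => szegoSolution α z v₁ j with hφdef
  set ψ : Finset.Icc (0 : ℤ) b → ℂ := fun j => szegoSolution α z (A.adjugate *ᵥ v₂) j with hψdef
  have h0b : (0 : ℤ) ≤ b := Int.natCast_nonneg b
  set o : Finset.Icc (0 : ℤ) b := ⟨0, Finset.mem_Icc.mpr ⟨le_rfl, h0b⟩⟩ with ho
  set e : Finset.Icc (0 : ℤ) b := ⟨b, Finset.mem_Icc.mpr ⟨h0b, le_rfl⟩⟩ with he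
  have hκ0 : κ ≠ 0 := by rintro rfl; simp at hκ
  have hφ' : P *ᵥ φ = Pi.single e (κ * w) := by
    funext i
    rw [hP, hφ i]
    have h1 : v₁ 1 + β * v₁ 0 = 0 := by simp [hv₁]
    have h2 : z * γ * (A *ᵥ v₁) 0 - (A *ᵥ v₁) 1 = w := by
      simp [hv₁, hwdef, boundaryForm, Matrix.mulVec, dotProduct, Fin.sum_univ_two]
      ring
    rw [h1, h2, ite_self, zero_add, Pi.single_apply]
    simp only [he, Subtype.ext_iff]
  have hψ' : P *ᵥ ψ = Pi.single o w := by
    funext i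
    rw [hP, hψ i]
    have h1 : (A.adjugate *ᵥ v₂) 1 + β * (A.adjugate *ᵥ v₂) 0 = w := by
      simp [hv₂, hwdef, boundaryForm, Matrix.mulVec, dotProduct, Fin.sum_univ_two,
        Matrix.adjugate_fin_two]
      ring
    have h2 : z * γ * (A *ᵥ A.adjugate *ᵥ v₂) 0 - (A *ᵥ A.adjugate *ᵥ v₂) 1 = 0 := by
      rw [Matrix.mulVec_mulVec, Matrix.mul_adjugate, Matrix.smul_mulVec, Matrix.one_mulVec]
      simp [hv₂]
      ring
    rw [h1, h2, mul_zero, ite_self, add_zero, Pi.single_apply]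
    simp only [ho, Subtype.ext_iff]
  have hunit : IsUnit P := by
    rw [Matrix.isUnit_iff_isUnit_det, isUnit_iff_ne_zero]
    intro hdet
    obtain ⟨x, hx0, hx⟩ := Matrix.exists_mulVec_eq_zero_iff.mpr hdet
    refine hx0 (eq_zero_of_pencil_mulVec_eq_zero hα hz hβ hγ hx ?_)
    -- By symmetry a kernel vector is orthogonal to `P ψ`, a multiple of the first basis vector.
    have h1 : x ⬝ᵥ (P *ᵥ ψ) = 0 := by
      rw [Matrix.dotProduct_mulVec, ← Matrix.mulVec_transpose, hP, pencil_transpose, ← hP, hx,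
        zero_dotProduct]
    rw [hψ', dotProduct_single] at h1
    exact (mul_eq_zero.mp h1).resolve_right hw
  have hdet := (Matrix.isUnit_iff_isUnit_det P).mp hunit
  have hinv : ∀ (y : Finset.Icc (0 : ℤ) b → ℂ) (i) (c : ℂ), c ≠ 0 → P *ᵥ y = Pi.single i c →
      ∀ l, P⁻¹ i l = y l / c := by
    intro y i c hc hy l
    have h1 : y = P⁻¹ *ᵥ Pi.single i c := by
      rw [← hy, Matrix.mulVec_mulVec, Matrix.nonsing_inv_mul P hdet, Matrix.one_mulVec]
    have h2 : P⁻¹ᵀ = P⁻¹ := by rw [Matrix.transpose_nonsing_inv, hP, pencil_transpose]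
    have h3 : P⁻¹ l i = P⁻¹ i l := congrFun (congrFun h2 i) l
    rw [h1, Matrix.mulVec_single, eq_div_iff hc]
    simp [h3]
  refine ⟨hunit, fun k l hl => ⟨fun hk => ?_, fun hk => ?_⟩⟩
  · obtain rfl : k = o := Subtype.ext hk
    have hlb : l ≤ b := by exact_mod_cast (Finset.mem_Icc.mp hl).2
    rw [green, hinv ψ o w hw hψ', norm_div]
    gcongr
    obtain ⟨j, hj⟩ := exists_norm_szegoSolution_eq hz (α := α) (A.adjugate *ᵥ v₂) l
    rw [hψdef, hj]
    have hsplit : A = transfer (fun j => α (l + j)) z (b - l) * transfer α z l := by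
      rw [← transfer_add, hA, Nat.add_sub_cancel' hlb]
    -- `A = S T_l` with `|det T_l| = 1`, so `T_l adj(A) = det(T_l) adj(S)`.
    have h1 : transfer α z l *ᵥ A.adjugate *ᵥ v₂ =
        z ^ l • ((transfer (fun j => α (l + j)) z (b - l)).adjugate *ᵥ v₂) := by
      rw [hsplit, Matrix.adjugate_mul_distrib, Matrix.mulVec_mulVec, ← Matrix.mul_assoc,
        Matrix.mul_adjugate, det_transfer z hα, Matrix.smul_mul, Matrix.one_mul,
        Matrix.smul_mulVec]
    rw [h1, Pi.smul_apply, norm_smul, norm_pow, hz, one_pow, one_mul]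
    exact norm_adjugate_mulVec_le (by simp [hv₂]) (by simp [hv₂, hz, hγ]) _ _
  · obtain rfl : k = e := Subtype.ext hk
    rw [green, hinv φ e (κ * w) (mul_ne_zero hκ0 hw) hφ', norm_div, norm_mul, hκ, one_mul]
    gcongr
    obtain ⟨j, hj⟩ := exists_norm_szegoSolution_eq hz (α := α) v₁ l
    rw [hφdef, hj]
    exact norm_mulVec_le (by simp [hv₁]) (by simp [hv₁, hβ]) _ _

end Green

/-! ### Exponential decay -/

/-- The factor `8`, from the constants `2` and `4` of the numerator and the denominator, is absorbed
by `exp 3`. -/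
theorem eight_mul_exp_div_le {s t c : ℝ} (h : 3 + s - t ≤ c) {w : ℝ}
    (hw : Real.exp t ≤ 4 * w) {p : ℝ} (hp : p ≤ Real.exp s) : 2 * p / w ≤ Real.exp c := by
  have hw0 : 0 < w := by linarith [Real.exp_pos t]
  have h8 : (8 : ℝ) ≤ Real.exp 3 := by
    have h1 := Real.add_one_le_exp (1 : ℝ)
    have h2 : Real.exp 3 = Real.exp 1 ^ 3 := by rw [← Real.exp_nat_mul]; norm_num
    rw [h2]
    calc (8 : ℝ) = 2 ^ 3 := by norm_num
      _ ≤ Real.exp 1 ^ 3 := by gcongr; linarith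
  rw [div_le_iff₀ hw0]
  have h3 : Real.exp 3 * Real.exp s ≤ Real.exp c * Real.exp t := by
    rw [← Real.exp_add, ← Real.exp_add]
    exact Real.exp_le_exp.mpr (by linarith)
  have h4 := mul_le_mul_of_nonneg_left hw (Real.exp_pos c).le
  have h5 := mul_le_mul_of_nonneg_right h8 (Real.exp_pos s).le
  linarith

end CMV

theorem theorem4p3 {Ω : Type*} [MetricSpace Ω] [CompactSpace Ω] [MeasurableSpace Ω] [BorelSpace Ω]
    (μ : Measure Ω) (T : Ω ≃ₜ Ω) (hT : CMV.IsStrictlyErgodic μ T)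
    (f : Ω → ℂ) (hf : Continuous f) (hf_disk : ∀ x, ‖f x‖ < 1)
    (z : ℂ) (hz : ‖z‖ = 1)
    (m : ℝ) (hm : 0 < m) (hmL : m < CMV.lyapunov μ T f z)
    (δ : ℝ) (hδ : 0 < δ)
    (β₀ γ₀ : ℂ) (hβ₀ : ‖β₀‖ = 1) (hγ₀ : ‖γ₀‖ = 1) :
    ∃ N : ℕ, ∀ n : ℕ, N ≤ n →
      ∃ S : Set Ω, MeasurableSet S ∧ 1 - δ ≤ μ.real S ∧
        ∀ x ∈ S, ∃ β ∈ ({-β₀, β₀} : Set ℂ), ∃ γ ∈ ({-γ₀, γ₀} : Set ℂ),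
          IsUnit (CMV.pencil (CMV.verblunsky T f x) 0 ((n : ℤ) - 1) β γ z) ∧
          ∀ k l : Finset.Icc (0 : ℤ) ((n : ℤ) - 1),
            ((k : ℤ) = 0 ∨ (k : ℤ) = (n : ℤ) - 1) →
            (n : ℝ) / 3 ≤ ((l : ℤ) : ℝ) → ((l : ℤ) : ℝ) ≤ 2 * (n : ℝ) / 3 →
            ‖CMV.green (CMV.verblunsky T f x) 0 ((n : ℤ) - 1) β γ z k l‖ ≤
              Real.exp (-m * |((k : ℤ) : ℝ) - ((l : ℤ) : ℝ)|) := by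
  set L := CMV.lyapunov μ T f z with hL
  -- The errors of the growth rates add up to at most about `2 n ε`, while replacing `L` by `m` gains
  -- `12 ε |k - l|`, which is about `4 n ε` or more.
  obtain ⟨ε, hε⟩ : ∃ ε, 12 * ε = L - m := ⟨(L - m) / 12, by ring⟩
  have hε0 : 0 < ε := by linarith
  obtain ⟨R, hR⟩ := eventually_atTop.mp
    (CMV.eventually_logTransfer_le hT hf hf_disk hz (show L < L + ε by linarith))
  obtain ⟨M, hM⟩ := eventually_atTop.mp
    ((CMV.eventually_measure_le_logTransfer hT hf hf_disk hz (show L - ε < L by linarith) hδ).and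
      ((tendsto_natCast_atTop_atTop.atTop_mul_const hε0).eventually_ge_atTop (3 + 8 * ε)))
  -- Both `l` and `b - l` are at least `R` as soon as `b ≥ 3 R + 2`.
  refine ⟨M + 3 * R + 3, fun n hn => ?_⟩
  obtain ⟨b, rfl⟩ := Nat.exists_eq_add_of_le' (show 1 ≤ n by omega)
  rw [show ((b + 1 : ℕ) : ℤ) - 1 = b by push_cast; ring]
  obtain ⟨hμ, hbε⟩ := hM b (by omega)
  refine ⟨{x | b * (L - ε) ≤ CMV.logTransfer T f z b x}, measurableSet_le measurable_const
    (CMV.continuous_logTransfer hf hf_disk hz b).measurable, hμ, fun x hx => ?_⟩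
  rw [Set.mem_ofPred_eq] at hx
  have hα : ∀ (x : Ω) (j : ℤ), ‖CMV.verblunsky T f x j‖ < 1 := fun _ _ => hf_disk _
  have hpos := fun x j => CMV.opNorm_transfer_pos (hα x) hz j
  have hup : ∀ r : ℕ, R ≤ r → ∀ y, CMV.opNorm (CMV.transfer (CMV.verblunsky T f y) z r) ≤
      Real.exp (r * (L + ε)) := fun r hr y =>
    (Real.log_le_iff_le_exp (hpos y r)).mp (hR r hr y)
  have hlow : Real.exp (b * (L - ε)) ≤ CMV.opNorm (CMV.transfer (CMV.verblunsky T f x) z b) :=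
    (Real.le_log_iff_exp_le (hpos x b)).mp hx
  obtain ⟨β, hβ, γ, hγ, hw⟩ := CMV.exists_opNorm_le_boundaryForm
    (CMV.transfer (CMV.verblunsky T f x) z b) hz hβ₀ hγ₀
  have hβ1 : ‖β‖ = 1 := by rcases hβ with rfl | rfl <;> simpa using hβ₀
  have hγ1 : ‖γ‖ = 1 := by rcases hγ with rfl | rfl <;> simpa using hγ₀
  have hexp := hlow.trans hw
  have hw0 : CMV.boundaryForm (CMV.transfer (CMV.verblunsky T f x) z b) β (z * γ) ≠ 0 := by
    intro h
    rw [h, norm_zero, mul_zero] at hexp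
    exact absurd hexp (not_le.mpr (Real.exp_pos _))
  obtain ⟨hunit, hgreen⟩ := CMV.isUnit_pencil_and_norm_green_le (hα x) hz hβ1 hγ1
    (show b ≠ 0 by omega) hw0
  refine ⟨β, hβ, γ, hγ, hunit, fun k l hk hl1 hl2 => ?_⟩
  obtain ⟨l, hl⟩ := l
  have hlb := Finset.mem_Icc.mp hl
  obtain ⟨l, rfl⟩ := Int.eq_ofNat_of_zero_le hlb.1
  have hlb' : l ≤ b := by exact_mod_cast hlb.2
  push_cast at hl1 hl2 ⊢
  have hl1' : b + 1 ≤ 3 * l := by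
    have : (b : ℝ) + 1 ≤ 3 * l := by linarith
    exact_mod_cast this
  have hl2' : 3 * l ≤ 2 * (b + 1) := by
    have : 3 * (l : ℝ) ≤ 2 * (b + 1) := by linarith
    exact_mod_cast this
  have hlε1 := mul_le_mul_of_nonneg_right hl1 hε0.le
  have hlε2 := mul_le_mul_of_nonneg_right hl2 hε0.le
  have hLm : L = m + 12 * ε := by linarith
  rcases hk with hk | hk
  · refine ((hgreen k l hl).1 hk).trans
      (CMV.eight_mul_exp_div_le ?_ hexp (by rw [CMV.verblunsky_shift]; exact hup _ (by omega) _))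
    rw [hk, Int.cast_zero, zero_sub, abs_neg, abs_of_nonneg (by positivity), Nat.cast_sub hlb',
      hLm]
    nlinarith
  · refine ((hgreen k l hl).2 hk).trans
      (CMV.eight_mul_exp_div_le ?_ hexp (hup _ (by omega) _))
    rw [hk, Int.cast_natCast, abs_of_nonneg (sub_nonneg.mpr (by exact_mod_cast hlb')), hLm]
    nlinarith
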